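/- Write $a \sim b$ when $a$ and $b$ are conjugate in the group considered. An element $x$ of a finite group $G$ is called \emph{rational} if all generators of $\langle x\rangle$ are conjugate to $x$; \emph{inverse semi-rational} if every generator of $\langle x\rangle$ is conjugate to $x$ or to $x^{-1}$; and \emph{semi-rational} if the generators of $\langle x\rangle$ are contained in a union of at most two conjugacy classes of $G$. The group $G$ is called rational, inverse semi-rational (ISR), or semi-rational (SR) if all its elements are. It is \emph{uniformly semi-rational} (USR) if there is an integer $m$ such that for every $x \in G$ every generator of $\langle x\rangle$ is conjugate to $x$ or to $x^m$. It is \emph{quadratic semi-rational} (QSR) if it is semi-rational and, for every irreducible complex character $\chi$ of $G$, the field $\mathbb{Q}(\chi)$ generated over $\mathbb{Q}$ by the values of $\chi$ is $\mathbb{Q}$ or a quadratic extension of $\mathbb{Q}$. Let $\mathfrak{X}$ be one of the four classes $\mathrm{ISR}$, $\mathrm{USR}$, $\mathrm{SR}$, $\mathrm{QSR}$. A finite nilpotent group $G$ is in $\mathfrak{X}$ if and only if at least one of the following holds: (i) $G$ is a $2$-group in $\mathfrak{X}$; (ii) $G$ is a $3$-group in $\mathfrak{X}$; (iii) $G \cong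 H \times K$, where $H$ is a rational $2$-group and $K$ is a $3$-group in $\mathfrak{X}$. Moreover, a finite nilpotent group $G$ satisfies (ii) if and only if $x^2 \sim x^{-1}$ for all $x \in G$. -/

import Mathlib

universe u

section RationalityClasses

/-- `x` is rational: all generators of `⟨x⟩` lie in the conjugacy class of `x`. -/
def IsRationalElement {G : Type u} [Group G] (x : G) : Prop :=
  ∀ y : G, Subgroup.zpowers y = Subgroup.zpowers x → IsConj x y

/-- `x` is semi-rational: all generators of `⟨x⟩` lie in a union of at most two conjugacy
classes. -/
def IsSemiRationalElement {G : Type u} [Group G] (x : G) : Prop :=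
  ∃ C D : ConjClasses G, ∀ y : G, Subgroup.zpowers y = Subgroup.zpowers x →
    y ∈ C.carrier ∨ y ∈ D.carrier

/-- `x` is inverse semi-rational: each generator of `⟨x⟩` is conjugate to `x` or to `x⁻¹`. -/
def IsInverseSemiRationalElement {G : Type u} [Group G] (x : G) : Prop :=
  ∀ y : G, Subgroup.zpowers y = Subgroup.zpowers x → IsConj x y ∨ IsConj x⁻¹ y

/-- Rational groups. -/
def IsRationalGroup (G : Type u) [Group G] : Prop :=
  ∀ x : G, IsRationalElement x

/-- Semi-rational groups (SR). -/
def IsSemiRational (G : Type u) [Group G] : Prop :=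
  ∀ x : G, IsSemiRationalElement x

/-- Inverse semi-rational groups (ISR). -/
def IsInverseSemiRational (G : Type u) [Group G] : Prop :=
  ∀ x : G, IsInverseSemiRationalElement x

/-- Uniformly semi-rational groups (USR): one integer `m` works for all elements `x`, in the
sense that each generator of `⟨x⟩` is conjugate to `x` or to `x ^ m`. -/
def IsUniformlySemiRational (G : Type u) [Group G] : Prop :=
  ∃ m : ℤ, ∀ x y : G, Subgroup.zpowers y = Subgroup.zpowers x → IsConj x y ∨ IsConj (x ^ m) y

/-- `Irr(G)`: the irreducible complex characters of `G`. Each finite-dimensional complex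
representation is isomorphic to one on some `ℂⁿ`. -/
def irreducibleCharacters (G : Type u) [Group G] : Set (G → ℂ) :=
  {χ | ∃ (n : ℕ) (ρ : Representation ℂ G (Fin n → ℂ)),
    ρ.IsIrreducible ∧ χ = ρ.character}

/-- The character field `ℚ(χ)`, generated over `ℚ` by the values of `χ`. -/
noncomputable def characterField {G : Type u} (χ : G → ℂ) : IntermediateField ℚ ℂ :=
  IntermediateField.adjoin ℚ (Set.range χ)

/-- Quadratic rational groups (QR): each character field is `ℚ` or a quadratic extension of `ℚ`. -/
def IsQuadraticRational (G : Type u) [Group G] : Prop :=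
  ∀ χ ∈ irreducibleCharacters G,
    characterField χ = ⊥ ∨ Module.finrank ℚ (characterField χ) = 2

/-- Quadratic semi-rational groups (QSR). -/
def IsQuadraticSemiRational (G : Type u) [Group G] : Prop :=
  IsSemiRational G ∧ IsQuadraticRational G

/-- Names for the four classes of groups. -/
inductive SemiRationalClass where
  | ISR
  | USR
  | SR
  | QSR

/-- The group `G` belongs to the class named `X`. -/
def SemiRationalClass.Contains (X : SemiRationalClass) (G : Type u) [Group G] : Prop :=
  match X with
  | .ISR => IsInverseSemiRational G
  | .USR => IsUniformlySemiRational G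
  | .SR => IsSemiRational G
  | .QSR => IsQuadraticSemiRational G

end RationalityClasses

/-! In a nilpotent group, if `x` is conjugate to `x ^ u`, iterated commutators give `x ^ ((u - 1) ^
n) = 1` for some `n`. So an `x ≠ 1` of odd order is conjugate neither to `x⁻¹` nor to `x ^ 2`.
Semi-rationality leaves two classes for these three generators, hence `x ^ 2 ∼ x⁻¹`, and the same
principle with `u = -2` makes the order of `x` a power of 3. Only the primes 2 and 3 survive, and
`G` is the product of its Sylow subgroups. A nontrivial 3-factor already uses both classes, on `y`
and `y⁻¹`, so the 2-factor is rational.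

Conversely, modulo `3 ^ k` the powers of `-2` are all the residues `u ≡ 1` mod 3. Thus in a 3-group
`x ^ 2 ∼ x⁻¹` for all `x` yields `x ∼ x ^ u` for such `u`. This gives ISR, hence USR and SR; by
Galois action it puts all character values in `ℚ(ω)` with `ω ^ 3 = 1`, hence QSR. So the four
classes agree on 3-groups, and a rational 2-factor does no harm. -/

/-! ### Conjugate powers in nilpotent groups -/

open scoped commutatorElement in
theorem exists_zpow_eq_one_of_isConj_zpow {G : Type*} [Group G] [Group.IsNilpotent G] {x : G}
    {u : ℤ} (h : IsConj x (x ^ u)) : ∃ n : ℕ, x ^ ((u - 1) ^ n) = 1 := by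
  obtain ⟨c, hc⟩ := isConj_iff.1 h
  obtain ⟨n, hn⟩ := Subgroup.nilpotent_iff_lowerCentralSeries.1 ‹Group.IsNilpotent G›
  have key : ∀ k : ℕ, x ^ ((u - 1) ^ k) ∈ (⊤ : Subgroup G).lowerCentralSeries k := by
    intro k
    induction k with
    | zero => simp
    | succ k ih =>
      -- Commutation with `c` multiplies the exponent by `u - 1` and descends one step of the
      -- central series.
      have h1 : x ^ ((u - 1) ^ (k + 1)) = ⁅c, x ^ ((u - 1) ^ k)⁆ := by
        rw [commutatorElement_def, ← conj_zpow, hc, ← zpow_mul, ← zpow_neg, ← zpow_add]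
        congr 1
        ring
      rw [h1, ← commutatorElement_inv, Subgroup.lowerCentralSeries_succ]
      exact inv_mem (Subgroup.commutator_mem_commutator ih (Subgroup.mem_top c))
  exact ⟨n, by simpa [hn] using key n⟩

theorem zpowers_zpow_eq_of_isCoprime {G : Type*} [Group G] {x : G} {u : ℤ}
    (h : IsCoprime u (orderOf x : ℤ)) : Subgroup.zpowers (x ^ u) = Subgroup.zpowers x := by
  obtain ⟨a, b, hab⟩ := h
  refine le_antisymm (Subgroup.zpowers_le.2 (Subgroup.zpow_mem_zpowers x u))
    (Subgroup.zpowers_le.2 (Subgroup.mem_zpowers_iff.2 ⟨a, ?_⟩))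
  rw [← zpow_mul, show u * a = 1 - orderOf x * b by linear_combination hab, zpow_sub, zpow_mul]
  simp

theorem isCoprime_orderOf_of_zpowers_zpow_eq {G : Type*} [Group G] [Finite G] {x : G} {u : ℤ}
    (h : Subgroup.zpowers (x ^ u) = Subgroup.zpowers x) : IsCoprime u (orderOf x : ℤ) := by
  obtain ⟨a, ha⟩ := Subgroup.mem_zpowers_iff.1 (h ▸ Subgroup.mem_zpowers x :
    x ∈ Subgroup.zpowers (x ^ u))
  have h1 : x ^ (u * a - 1) = 1 := by rw [zpow_sub, zpow_mul, ha]; simp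
  obtain ⟨b, hb⟩ := orderOf_dvd_iff_zpow_eq_one.2 h1
  exact ⟨a, -b, by linear_combination hb⟩

theorem IsConj.zpow {G : Type*} [Group G] {a b : G} (h : IsConj a b) (n : ℤ) :
    IsConj (a ^ n) (b ^ n) := by
  obtain ⟨c, rfl⟩ := isConj_iff.1 h
  exact isConj_iff.2 ⟨c, conj_zpow.symm⟩

theorem IsConj.map_hom {G H : Type*} [Group G] [Group H] (f : G →* H) {a b : G}
    (h : IsConj a b) : IsConj (f a) (f b) := f.map_isConj h

theorem IsConj.prodMk {G H : Type*} [Group G] [Group H] {a b : G} {c d : H}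
    (h : IsConj a b) (h' : IsConj c d) : IsConj (a, c) (b, d) := by
  obtain ⟨e, rfl⟩ := isConj_iff.1 h
  obtain ⟨f, rfl⟩ := isConj_iff.1 h'
  exact isConj_iff.2 ⟨(e, f), rfl⟩

/-! ### Semi-rationality and elements of odd order -/

theorem IsSemiRationalElement.isConj_of_three {G : Type u} [Group G] {x : G}
    (h : IsSemiRationalElement x) {a b c : G}
    (ha : Subgroup.zpowers a = Subgroup.zpowers x) (hb : Subgroup.zpowers b = Subgroup.zpowers x)
    (hc : Subgroup.zpowers c = Subgroup.zpowers x) : IsConj a b ∨ IsConj a c ∨ IsConj b c := by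
  obtain ⟨C, D, h⟩ := h
  have ha := h a ha
  have hb := h b hb
  have hc := h c hc
  simp only [ConjClasses.mem_carrier_iff_mk_eq, ← ConjClasses.mk_eq_mk_iff_isConj] at *
  grind

theorem IsInverseSemiRational.isUniformlySemiRational {G : Type u} [Group G]
    (h : IsInverseSemiRational G) : IsUniformlySemiRational G :=
  ⟨-1, fun x y hy => by simpa using h x y hy⟩

theorem IsUniformlySemiRational.isSemiRational {G : Type u} [Group G]
    (h : IsUniformlySemiRational G) : IsSemiRational G := by
  obtain ⟨m, h⟩ := h
  refine fun x => ⟨ConjClasses.mk x, ConjClasses.mk (x ^ m), fun y hy => ?_⟩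
  simpa only [ConjClasses.mem_carrier_iff_mk_eq, ConjClasses.mk_eq_mk_iff_isConj,
    isConj_comm (g := y)] using h x y hy

theorem SemiRationalClass.Contains.isSemiRational {X : SemiRationalClass} {G : Type u} [Group G]
    (h : X.Contains G) : IsSemiRational G := by
  cases X with
  | ISR => exact (IsInverseSemiRational.isUniformlySemiRational h).isSemiRational
  | USR => exact IsUniformlySemiRational.isSemiRational h
  | SR => exact h
  | QSR => exact h.1

theorem IsSemiRational.of_surjective_of_section {G K : Type u} [Group G] [Group K]
    (h : IsSemiRational G) (p : G →* K) (s : K →* G) (hps : ∀ k, p (s k) = k) :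
    IsSemiRational K := by
  intro x
  obtain ⟨C, D, hCD⟩ := h (s x)
  refine ⟨ConjClasses.map p C, ConjClasses.map p D, fun y hy => ?_⟩
  have := hCD (s y) (by rw [← MonoidHom.map_zpowers, ← MonoidHom.map_zpowers, hy])
  simp only [ConjClasses.mem_carrier_iff_mk_eq] at *
  refine this.imp ?_ ?_ <;>
  · rintro rfl
    exact congrArg ConjClasses.mk (hps y).symm

theorem eq_one_of_isConj_inv {G : Type*} [Group G] [Group.IsNilpotent G] {x : G}
    (hx : Odd (orderOf x)) (h : IsConj x x⁻¹) : x = 1 := by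
  rw [← zpow_neg_one] at h
  obtain ⟨n, hn⟩ := exists_zpow_eq_one_of_isConj_zpow h
  have h2 : IsCoprime (2 : ℤ) (orderOf x : ℤ) := by
    exact_mod_cast Nat.isCoprime_iff_coprime.2 (Nat.coprime_two_left.2 hx)
  have h4 : IsCoprime ((-1 - 1 : ℤ) ^ n) (orderOf x : ℤ) := by
    refine IsCoprime.pow_left ?_
    simpa using h2.neg_left
  have h5 := h4.symm.isUnit_of_dvd' dvd_rfl (orderOf_dvd_iff_zpow_eq_one.2 hn)
  rw [Int.isUnit_iff] at h5
  exact orderOf_eq_one_iff.1 (by omega)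

theorem isConj_sq_inv_of_isSemiRational {G : Type u} [Group G] [Finite G] [Group.IsNilpotent G]
    (h : IsSemiRational G) {x : G} (hx : Odd (orderOf x)) : IsConj (x ^ 2) x⁻¹ := by
  have h2 : IsCoprime (2 : ℤ) (orderOf x : ℤ) := by
    exact_mod_cast Nat.isCoprime_iff_coprime.2 (Nat.coprime_two_left.2 hx)
  have h2' : Subgroup.zpowers (x ^ 2) = Subgroup.zpowers x := by
    simpa using zpowers_zpow_eq_of_isCoprime h2
  suffices hs : x = 1 ∨ IsConj (x ^ 2) x⁻¹ by
    rcases hs with rfl | hs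
    · simp
    · exact hs
  rcases (h x).isConj_of_three rfl (Subgroup.zpowers_inv (g := x)) h2' with h1 | h1 | h1
  · exact Or.inl (eq_one_of_isConj_inv hx h1)
  · left
    obtain ⟨n, hn⟩ := exists_zpow_eq_one_of_isConj_zpow (u := 2) (by simpa using h1)
    simpa using hn
  · exact Or.inr h1.symm

theorem exists_pow_three_pow_eq_one_of_isConj {G : Type*} [Group G] [Group.IsNilpotent G] {x : G}
    (h : IsConj (x ^ 2) x⁻¹) : ∃ n : ℕ, x ^ 3 ^ n = 1 := by
  -- Read as `x⁻¹ ∼ (x⁻¹) ^ (-2)`, so that `u - 1 = -3`.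
  obtain ⟨n, hn⟩ := exists_zpow_eq_one_of_isConj_zpow (x := x⁻¹) (u := -2)
    (by simpa using h.symm)
  refine ⟨n, ?_⟩
  have h1 : x ^ (((-2 : ℤ) - 1) ^ n) = 1 := by simpa using hn
  have h2 := orderOf_dvd_iff_zpow_eq_one.2 h1
  rw [← orderOf_dvd_iff_pow_eq_one, ← Int.natCast_dvd_natCast]
  refine h2.trans ?_
  rw [show (-2 - 1 : ℤ) = -3 by norm_num, neg_pow, ((isUnit_one.neg).pow n).mul_left_dvd]
  push_cast
  exact dvd_rfl

/-! ### 3-groups with `x ^ 2 ∼ x⁻¹` -/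

theorem exists_neg_two_pow_modEq {u : ℤ} (hu : u ≡ 1 [ZMOD 3]) (k : ℕ) :
    ∃ j : ℕ, (-2) ^ j ≡ u [ZMOD 3 ^ k] := by
  have key : ∀ k : ℕ, ∃ t : ℤ, (-2 : ℤ) ^ 3 ^ k = 1 + 3 ^ (k + 1) * t ∧ ¬ (3 : ℤ) ∣ t := by
    intro k
    induction k with
    | zero => exact ⟨-1, by norm_num⟩
    | succ k ih =>
      obtain ⟨t, ht, ht3⟩ := ih
      refine ⟨t + 3 ^ (k + 1) * t ^ 2 + 3 ^ (k + 1) * (3 ^ k * t ^ 3), ?_, ?_⟩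
      · rw [pow_succ, pow_mul, ht]
        ring
      · rw [pow_succ (3 : ℤ) k]
        intro hd
        refine ht3 ?_
        have := dvd_sub hd (Dvd.intro (3 ^ k * t ^ 2 + 3 ^ k * (3 ^ k * t ^ 3)) rfl)
        ring_nf at this ⊢
        exact this
  induction k with
  | zero => exact ⟨0, by simp [Int.modEq_one]⟩
  | succ k ih =>
    obtain ⟨j, hj⟩ := ih
    rcases k with _ | k
    · exact ⟨0, by simpa using hu.symm⟩
    obtain ⟨t, ht, ht3⟩ := key k
    obtain ⟨s, hs⟩ := hj.dvd
    have hj3 : ¬ (3 : ℤ) ∣ (-2) ^ j := fun hd => by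
      have := Int.prime_three.dvd_of_dvd_pow hd
      norm_num at this
    have hcop : IsCoprime ((-2) ^ j * t) 3 :=
      ((Int.prime_three.coprime_iff_not_dvd.2
        fun hd => (Int.prime_three.dvd_or_dvd hd).elim hj3 ht3)).symm
    obtain ⟨a, b, hab⟩ := hcop
    -- Here `u - (-2) ^ j = 3 ^ (k + 1) * s`, and `a` inverts `(-2) ^ j * t` mod 3; multiplying
    -- `(-2) ^ j` by `(1 + 3 ^ (k + 1) * t) ^ i` corrects the next ternary digit.
    obtain ⟨i, hi⟩ : ∃ i : ℕ, (i : ℤ) ≡ a * s [ZMOD 3] := by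
      refine ⟨((a * s) % 3).toNat, ?_⟩
      rw [Int.toNat_of_nonneg (Int.emod_nonneg _ (by norm_num))]
      exact Int.mod_modEq _ _
    have hexp : (1 + 3 ^ (k + 1) * t) ^ i ≡ 1 + 3 ^ (k + 1) * t * i [ZMOD 3 ^ (k + 2)] := by
      clear hi
      induction i with
      | zero => simp
      | succ i ih =>
        rw [pow_succ (1 + 3 ^ (k + 1) * t) i]
        refine (ih.mul_right _).trans (Int.modEq_iff_dvd.2 ⟨-(3 ^ k * t ^ 2 * i), ?_⟩)
        push_cast
        ring
    refine ⟨j + 3 ^ k * i, ?_⟩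
    rw [pow_add (-2 : ℤ), pow_mul, ht]
    refine (hexp.mul_left _).trans ?_
    obtain ⟨r, hr⟩ := hi.dvd
    refine Int.modEq_iff_dvd.2 ⟨(-2) ^ j * t * r + b * s, ?_⟩
    linear_combination hs + 3 ^ (k + 1) * (-2) ^ j * t * hr - 3 ^ (k + 1) * s * hab

theorem isConj_zpow_of_modEq_one {G : Type*} [Group G] (h3 : IsPGroup 3 G)
    (h : ∀ x : G, IsConj (x ^ 2) x⁻¹) (x : G) {u : ℤ} (hu : u ≡ 1 [ZMOD 3]) :
    IsConj x (x ^ u) := by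
  obtain ⟨k, hk⟩ := h3 x
  obtain ⟨j, hj⟩ := exists_neg_two_pow_modEq hu k
  have hstep : ∀ j : ℕ, IsConj x (x ^ ((-2 : ℤ) ^ j)) := by
    intro j
    induction j with
    | zero => simpa using IsConj.refl x
    | succ j ih =>
      refine ih.trans ?_
      have := (h (x ^ ((-2 : ℤ) ^ j))⁻¹).symm
      rw [inv_inv, ← zpow_neg, ← zpow_natCast, ← zpow_mul] at this
      rw [pow_succ]
      convert this using 2
      push_cast
      ring
  have hxu : x ^ ((-2 : ℤ) ^ j) = x ^ u := by
    rw [zpow_eq_zpow_iff_modEq]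
    refine hj.of_dvd ?_
    exact_mod_cast orderOf_dvd_of_pow_eq_one hk
  exact hxu ▸ hstep j

theorem isInverseSemiRational_of_isConj_sq_inv {G : Type u} [Group G] [Finite G]
    (h3 : IsPGroup 3 G) (h : ∀ x : G, IsConj (x ^ 2) x⁻¹) : IsInverseSemiRational G := by
  intro x y hy
  obtain ⟨u, rfl⟩ := Subgroup.mem_zpowers_iff.1 (hy ▸ Subgroup.mem_zpowers y)
  by_cases hx : x = 1
  · subst hx
    simp
  have h3x : 3 ∣ orderOf x := by
    obtain ⟨k, hk⟩ := IsPGroup.iff_orderOf.1 h3 x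
    rw [hk]
    refine dvd_pow_self 3 fun h0 => hx ?_
    rw [← orderOf_eq_one_iff, hk, h0, pow_zero]
  have hu : IsCoprime u 3 :=
    (isCoprime_orderOf_of_zpowers_zpow_eq hy).of_isCoprime_of_dvd_right (by exact_mod_cast h3x)
  have hu' : ¬ (3 : ℤ) ∣ u := Int.prime_three.coprime_iff_not_dvd.1 hu.symm
  rcases (by omega : u % 3 = 1 ∨ (-u) % 3 = 1) with h1 | h1
  · exact Or.inl (isConj_zpow_of_modEq_one h3 h x h1)
  · right
    simpa using isConj_zpow_of_modEq_one h3 h x⁻¹ h1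

/-! ### Character fields -/

open Module in
-- `X ^ n - 1` is separable, so `f` is diagonalizable. One choice of eigenvalues and multiplicities
-- serves every `k`, which lets `ζ ↦ ζ ^ k` carry `χ(g)` to `χ(g ^ k)`.
theorem LinearMap.exists_trace_pow_eq_sum_of_pow_eq_one {K V : Type*} [Field K] [IsAlgClosed K]
    [CharZero K] [AddCommGroup V] [Module K V] [FiniteDimensional K V] {f : End K V} {n : ℕ}
    (hn : n ≠ 0) (hf : f ^ n = 1) :
    ∃ (s : Finset K) (m : K → ℕ), (∀ μ ∈ s, μ ^ n = 1) ∧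
      ∀ k : ℕ, LinearMap.trace K V (f ^ k) = ∑ μ ∈ s, m μ * μ ^ k := by
  classical
  have hss : f.IsSemisimple := by
    refine End.isSemisimple_of_squarefree_aeval_eq_zero
      (p := Polynomial.X ^ n - 1) ?_ (by simp [hf])
    exact (Polynomial.separable_X_pow_sub_C (1 : K) (Nat.cast_ne_zero.2 hn) one_ne_zero).squarefree
  have hint : DirectSum.IsInternal fun μ : K => f.eigenspace μ := by
    refine DirectSum.isInternal_submodule_of_iSupIndep_of_iSup_eq_top f.eigenspaces_iSupIndep ?_
    simp_rw [← hss.isFinitelySemisimple.maxGenEigenspace_eq_eigenspace]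
    exact f.iSup_maxGenEigenspace_eq_top
  have hfin : {μ : K | f.eigenspace μ ≠ ⊥}.Finite :=
    WellFoundedGT.finite_ne_bot_of_iSupIndep f.eigenspaces_iSupIndep
  refine ⟨hfin.toFinset, fun μ => finrank K (f.eigenspace μ), fun μ hμ => ?_, fun k => ?_⟩
  · have hμ' : f.HasEigenvalue μ := Module.End.hasEigenvalue_iff.2 (hfin.mem_toFinset.1 hμ)
    obtain ⟨v, hv⟩ := hμ'.exists_hasEigenvector
    have h1 := hv.pow_apply n
    rw [hf, Module.End.one_apply] at h1
    have h2 : (μ ^ n - 1) • v = 0 := by rw [sub_smul, ← h1, one_smul, sub_self]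
    exact sub_eq_zero.1 ((smul_eq_zero.1 h2).resolve_right hv.2)
  · have hpow : ∀ μ : K, ∀ v ∈ f.eigenspace μ, (f ^ k) v = μ ^ k • v := fun μ v hv => by
      by_cases h0 : v = 0
      · simp [h0]
      · exact Module.End.HasEigenvector.pow_apply ⟨hv, h0⟩ k
    have hmaps : ∀ μ : K, Set.MapsTo (f ^ k) (f.eigenspace μ) (f.eigenspace μ) := fun μ v hv => by
      rw [hpow μ v hv]
      exact Submodule.smul_mem _ _ hv
    rw [LinearMap.trace_eq_sum_trace_restrict' hint hfin hmaps]
    refine Finset.sum_congr rfl fun μ _ => ?_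
    have : (f ^ k).restrict (hmaps μ) = μ ^ k • LinearMap.id := by
      ext ⟨v, hv⟩
      exact hpow μ v hv
    rw [this, map_smul, LinearMap.trace_id, smul_eq_mul, mul_comm]

open IntermediateField in
theorem IntermediateField.finrank_adjoin_simple_le_two {F E : Type*} [Field F] [Field E]
    [Algebra F E] {x : E} (h : x ^ 2 + x + 1 = 0) : Module.finrank F F⟮x⟯ ≤ 2 := by
  have hm : (Polynomial.X ^ 2 + Polynomial.X + 1 : Polynomial F).Monic := by monicity!
  have h0 : Polynomial.aeval x (Polynomial.X ^ 2 + Polynomial.X + 1 : Polynomial F) = 0 := by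
    simpa using h
  rw [IntermediateField.adjoin.finrank ⟨_, hm, by simpa using h0⟩]
  refine (Polynomial.natDegree_le_natDegree (minpoly.min F x hm h0)).trans ?_
  compute_degree

open IntermediateField in
theorem IntermediateField.eq_bot_or_finrank_eq_two_of_le_map_adjoin {k A B : Type*} [Field k]
    [Field A] [Field B] [Algebra k A] [Algebra k B] {x : A} (hx : x ^ 2 + x + 1 = 0)
    (φ : A →ₐ[k] B) {C : IntermediateField k B} (hle : C ≤ k⟮x⟯.map φ) :
    C = ⊥ ∨ Module.finrank k C = 2 := by
  have hint : IsIntegral k x :=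
    ⟨Polynomial.X ^ 2 + Polynomial.X + 1, by monicity!, by simpa using hx⟩
  have : FiniteDimensional k k⟮x⟯ := IntermediateField.adjoin.finiteDimensional hint
  have : FiniteDimensional k (k⟮x⟯.map φ) :=
    (IntermediateField.equivMap k⟮x⟯ φ).toLinearEquiv.finiteDimensional
  have hle2 : Module.finrank k C ≤ 2 := by
    refine le_trans ?_ (IntermediateField.finrank_adjoin_simple_le_two (F := k) hx)
    rw [(IntermediateField.equivMap k⟮x⟯ φ).toLinearEquiv.finrank_eq]
    exact LinearMap.finrank_le_finrank_of_injective
      (f := (IntermediateField.inclusion hle).toLinearMap) (IntermediateField.inclusion hle).injective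
  have : FiniteDimensional k C :=
    FiniteDimensional.of_injective (IntermediateField.inclusion hle).toLinearMap
      (IntermediateField.inclusion hle).injective
  have hpos : 0 < Module.finrank k C := Module.finrank_pos
  rcases (by omega : Module.finrank k C = 1 ∨ Module.finrank k C = 2) with h1 | h1
  · exact Or.inl (IntermediateField.finrank_eq_one_iff.1 h1)
  · exact Or.inr h1

open IntermediateField in
theorem IsQuadraticRational.of_isConj_pow_of_isCyclotomicExtension {G : Type u} [Group G] [Finite G]
    (E : Type*) [Field E] [Algebra ℚ E] [IsCyclotomicExtension {3 * Nat.card G} ℚ E]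
    (h : ∀ (g : G) (k : ℕ), k.Coprime (Nat.card G) → k ≡ 1 [MOD 3] → IsConj g (g ^ k)) :
    IsQuadraticRational G := by
  rintro χ ⟨n, ρ, -, rfl⟩
  -- The factor 3 puts a primitive cube root of unity, `ζ ^ Nat.card G`, in `E`.
  set N : ℕ := 3 * Nat.card G with hN
  have hN0 : N ≠ 0 := mul_ne_zero three_ne_zero Nat.card_pos.ne'
  have : NeZero N := ⟨hN0⟩
  have : IsCyclotomicExtension {N} ℚ E := ‹_›
  have hGal : IsGalois ℚ E := IsCyclotomicExtension.isGalois {N} ℚ E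
  have : FiniteDimensional ℚ E := IsCyclotomicExtension.finiteDimensional {N} ℚ E
  let φ : E →ₐ[ℚ] ℂ := IsAlgClosed.lift
  let ζ : E := IsCyclotomicExtension.zeta N ℚ E
  have hζ : IsPrimitiveRoot ζ N := IsCyclotomicExtension.zeta_spec N ℚ E
  have hζφ : IsPrimitiveRoot (φ ζ) N := hζ.map_of_injective φ.injective
  have hω : IsPrimitiveRoot (ζ ^ Nat.card G) 3 :=
    hζ.pow (Nat.pos_of_ne_zero hN0) (mul_comm _ _)
  let F : IntermediateField ℚ E := ℚ⟮ζ ^ Nat.card G⟯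
  have hωE : (ζ ^ Nat.card G) ^ 2 + ζ ^ Nat.card G + 1 = 0 := by
    have := hω.geom_sum_eq_zero (by norm_num)
    simp only [Finset.sum_range_succ, Finset.sum_range_zero] at this
    linear_combination this
  have hle : characterField ρ.character ≤ F.map φ := by
    refine IntermediateField.adjoin_le_iff.2 ?_
    rintro _ ⟨g, rfl⟩
    have hgN : (ρ g) ^ N = 1 := by
      rw [← map_pow, hN, mul_comm, pow_mul, pow_card_eq_one', one_pow, map_one]
    obtain ⟨s, m, hs, htr⟩ := LinearMap.exists_trace_pow_eq_sum_of_pow_eq_one hN0 hgN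
    have hex : ∀ μ : ℂ, ∃ i : ℕ, μ ∈ s → φ ζ ^ i = μ := fun μ => by
      by_cases hμ : μ ∈ s
      · obtain ⟨i, -, hi⟩ := hζφ.eq_pow_of_pow_eq_one (hs μ hμ)
        exact ⟨i, fun _ => hi⟩
      · exact ⟨0, fun h => absurd h hμ⟩
    choose i hi using hex
    have hchar : ∀ k : ℕ, ρ.character (g ^ k) = φ (∑ μ ∈ s, m μ * (ζ ^ k) ^ i μ) := fun k => by
      rw [Representation.character, map_pow, htr, map_sum]
      refine Finset.sum_congr rfl fun μ hμ => ?_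
      rw [map_mul, map_natCast, map_pow, map_pow, ← pow_mul, mul_comm k, pow_mul, hi μ hμ]
    rw [← pow_one g, hchar 1, pow_one]
    refine ⟨_, ?_, rfl⟩
    change _ ∈ F
    -- An automorphism fixing the cube root is `ζ ↦ ζ ^ k` with `k ≡ 1` mod 3, so it sends the value
    -- at `g` to that at the conjugate `g ^ k`.
    rw [← IsGalois.fixedField_fixingSubgroup F, IntermediateField.mem_fixedField_iff]
    intro σ hσ
    obtain ⟨k, -, hk⟩ := hζ.eq_pow_of_pow_eq_one
      (show (σ ζ) ^ N = 1 by rw [← map_pow, hζ.pow_eq_one, map_one])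
    have hprim : IsPrimitiveRoot (ζ ^ k) N := hk ▸ hζ.map_of_injective σ.injective
    have hcop : k.Coprime N := (hζ.pow_iff_coprime (Nat.pos_of_ne_zero hN0) k).1 hprim
    have h3 : k ≡ 1 [MOD 3] := by
      have h1 : σ (ζ ^ Nat.card G) = ζ ^ Nat.card G :=
        (IntermediateField.mem_fixingSubgroup_iff F σ).1 hσ _
          (IntermediateField.mem_adjoin_simple_self ℚ _)
      rw [map_pow, ← hk, ← pow_mul, mul_comm, pow_mul] at h1
      have h3 : IsUnit.unit (hω.isUnit (by norm_num)) ^ k = IsUnit.unit (hω.isUnit (by norm_num)) ^ 1 :=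
        Units.ext (by simpa using h1)
      have h4 := pow_eq_pow_iff_modEq.1 h3
      rwa [orderOf_units.symm, IsUnit.unit_spec, ← hω.eq_orderOf] at h4
    have hconj := h g k (hcop.coprime_dvd_right (Dvd.intro_left 3 rfl)) h3
    apply φ.injective
    rw [map_sum]
    simp only [map_mul, map_natCast, map_pow, ← hk]
    have e1 := hchar k
    have e2 := hchar 1
    obtain ⟨c, hc⟩ := isConj_iff.1 hconj
    rw [← hc, Representation.char_conj, ← pow_one g, e2] at e1
    simpa using e1.symm
  exact IntermediateField.eq_bot_or_finrank_eq_two_of_le_map_adjoin hωE φ hle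

theorem IsQuadraticRational.of_isConj_pow {G : Type u} [Group G] [Finite G]
    (h : ∀ (g : G) (k : ℕ), k.Coprime (Nat.card G) → k ≡ 1 [MOD 3] → IsConj g (g ^ k)) :
    IsQuadraticRational G :=
  haveI : NeZero (3 * Nat.card G) := ⟨mul_ne_zero three_ne_zero Nat.card_pos.ne'⟩
  haveI : NeZero ((3 * Nat.card G : ℕ) : ℚ) := NeZero.charZero
  @IsQuadraticRational.of_isConj_pow_of_isCyclotomicExtension G _ _
    (CyclotomicField (3 * Nat.card G) ℚ) _ (CyclotomicField.algebra _ _)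
    (CyclotomicField.isCyclotomicExtension _ _) h

theorem SemiRationalClass.contains_of_isConj_pow {G : Type u} [Group G] [Finite G]
    (X : SemiRationalClass) (hi : IsInverseSemiRational G)
    (h : ∀ (g : G) (k : ℕ), k.Coprime (Nat.card G) → k ≡ 1 [MOD 3] → IsConj g (g ^ k)) :
    X.Contains G := by
  cases X with
  | ISR => exact hi
  | USR => exact hi.isUniformlySemiRational
  | SR => exact hi.isUniformlySemiRational.isSemiRational
  | QSR => exact ⟨hi.isUniformlySemiRational.isSemiRational, .of_isConj_pow h⟩

theorem IsPGroup.odd_orderOf_of_three {G : Type*} [Group G] (h : IsPGroup 3 G) (x : G) :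
    Odd (orderOf x) := by
  obtain ⟨k, hk⟩ := IsPGroup.iff_orderOf.1 h x
  exact hk ▸ Odd.pow (by decide)

theorem isPGroup_three_and_contains_iff (X : SemiRationalClass) (G : Type u) [Group G] [Finite G]
    [Group.IsNilpotent G] :
    (IsPGroup 3 G ∧ X.Contains G) ↔ ∀ x : G, IsConj (x ^ 2) x⁻¹ := by
  refine ⟨fun ⟨h3, hX⟩ x => isConj_sq_inv_of_isSemiRational hX.isSemiRational
    (h3.odd_orderOf_of_three x), fun h => ?_⟩
  have h3 : IsPGroup 3 G := fun x => exists_pow_three_pow_eq_one_of_isConj (h x)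
  refine ⟨h3, X.contains_of_isConj_pow (isInverseSemiRational_of_isConj_sq_inv h3 h)
    fun g k _ hk => ?_⟩
  simpa using isConj_zpow_of_modEq_one h3 h g (u := k) (by exact_mod_cast hk)

/-! ### Direct products and Sylow factors -/

theorem zpowers_prodMk_eq_of_coprime {H K : Type*} [Group H] [Group K] {a a' : H} {b b' : K}
    (hcop : (orderOf a).Coprime (orderOf b))
    (ha : Subgroup.zpowers a' = Subgroup.zpowers a)
    (hb : Subgroup.zpowers b' = Subgroup.zpowers b) :
    Subgroup.zpowers (a', b') = Subgroup.zpowers (a, b) := by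
  have key : ∀ {a a' : H} {b b' : K}, (orderOf a).Coprime (orderOf b) →
      a' ∈ Subgroup.zpowers a → b' ∈ Subgroup.zpowers b →
      (a', b') ∈ Subgroup.zpowers (a, b) := by
    rintro a _ b _ hcop ⟨u, rfl⟩ ⟨v, rfl⟩
    obtain ⟨s, t, hst⟩ := Nat.isCoprime_iff_coprime.2 hcop
    -- Chinese remainder: the exponent is `u` mod `orderOf a` and `v` mod `orderOf b`.
    refine ⟨u * (t * orderOf b) + v * (s * orderOf a), Prod.ext ?_ ?_⟩
    · dsimp only [Prod.pow_mk]
      rw [zpow_eq_zpow_iff_modEq]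
      exact Int.modEq_iff_dvd.2 ⟨(u - v) * s, by linear_combination -u * hst⟩
    · dsimp only [Prod.pow_mk]
      rw [zpow_eq_zpow_iff_modEq]
      exact Int.modEq_iff_dvd.2 ⟨(v - u) * t, by linear_combination -v * hst⟩
  have hcop' : (orderOf a').Coprime (orderOf b') := by
    rwa [← Nat.card_zpowers, ← Nat.card_zpowers, ha, hb, Nat.card_zpowers, Nat.card_zpowers]
  exact le_antisymm
    (Subgroup.zpowers_le.2 (key hcop (ha ▸ Subgroup.mem_zpowers a') (hb ▸ Subgroup.mem_zpowers b')))
    (Subgroup.zpowers_le.2 (key hcop' (ha ▸ Subgroup.mem_zpowers a) (hb ▸ Subgroup.mem_zpowers b)))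

theorem IsInverseSemiRational.prod_of_isRationalGroup {H K : Type u} [Group H] [Group K]
    (hH : IsRationalGroup H) (hK : IsInverseSemiRational K) : IsInverseSemiRational (H × K) := by
  rintro ⟨a, b⟩ ⟨a', b'⟩ h
  have ha := congrArg (Subgroup.map (MonoidHom.fst H K)) h
  have hb := congrArg (Subgroup.map (MonoidHom.snd H K)) h
  simp only [MonoidHom.map_zpowers, MonoidHom.coe_fst, MonoidHom.coe_snd] at ha hb
  refine (hK b b' hb).imp (fun hc => (hH a a' ha).prodMk hc) fun hc => ?_
  exact (hH a⁻¹ a' (ha.trans Subgroup.zpowers_inv.symm)).prodMk hc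

theorem IsInverseSemiRational.of_mulEquiv {G K : Type u} [Group G] [Group K] (e : G ≃* K)
    (h : IsInverseSemiRational K) : IsInverseSemiRational G := by
  intro x y hy
  have := h (e x) (e y) (by
    have := congrArg (Subgroup.map e.toMonoidHom) hy
    rwa [MonoidHom.map_zpowers, MonoidHom.map_zpowers] at this)
  refine this.imp (fun hc => ?_) fun hc => ?_
  · simpa using hc.map_hom e.symm.toMonoidHom
  · simpa using hc.map_hom e.symm.toMonoidHom

theorem SemiRationalClass.contains_of_mulEquiv_prod (X : SemiRationalClass) {G H K : Type u}
    [Group G] [Finite G] [Group H] [Group K] (hH : IsRationalGroup H)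
    (h3 : IsPGroup 3 K) (hK : X.Contains K) (e : G ≃* H × K) : X.Contains G := by
  have : Finite (H × K) := Finite.of_equiv G e.toEquiv
  have : Finite H := Finite.of_surjective (Prod.fst : H × K → H) Prod.fst_surjective
  have : Finite K := Finite.of_surjective (Prod.snd : H × K → K) Prod.snd_surjective
  have : Fact (Nat.Prime 3) := ⟨Nat.prime_three⟩
  have : Fact (Nat.Prime 2) := ⟨Nat.prime_two⟩
  have : Group.IsNilpotent K := h3.isNilpotent
  have hc := (isPGroup_three_and_contains_iff X K).1 ⟨h3, hK⟩
  refine X.contains_of_isConj_pow (.of_mulEquiv e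
    (.prod_of_isRationalGroup hH (isInverseSemiRational_of_isConj_sq_inv h3 hc)))
    fun g k hk hk3 => ?_
  suffices hs : IsConj (e g) (e (g ^ k)) by simpa using hs.map_hom e.symm.toMonoidHom
  rw [map_pow]
  have h1 : IsConj (e g).1 ((e g).1 ^ k) := by
    refine hH _ _ ?_
    have hdvd : orderOf (e g).1 ∣ Nat.card G :=
      (orderOf_dvd_natCard _).trans (by
        rw [Nat.card_congr e.toEquiv, Nat.card_prod]
        exact dvd_mul_right _ _)
    simpa using zpowers_zpow_eq_of_isCoprime (x := (e g).1) (u := k)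
      (Nat.isCoprime_iff_coprime.2 (hk.coprime_dvd_right hdvd))
  have h2 : IsConj (e g).2 ((e g).2 ^ k) := by
    simpa using isConj_zpow_of_modEq_one h3 hc (e g).2 (u := k) (by exact_mod_cast hk3)
  exact h1.prodMk h2

/-- For `y ≠ 1` in `K`, two of `(x, y)`, `(x, y⁻¹)`, `(x', y)` are conjugate; since `y ≁ y⁻¹`, they
are the first and the third. -/
theorem isRationalGroup_of_isSemiRational_prod {H K : Type u} [Group H] [Group K] [Finite H]
    [Finite K] [Nontrivial K] (h2 : IsPGroup 2 H) (h3 : IsPGroup 3 K)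
    (h : IsSemiRational (H × K)) : IsRationalGroup H := by
  intro x x' hx
  have : Fact (Nat.Prime 3) := ⟨Nat.prime_three⟩
  have : Group.IsNilpotent K := h3.isNilpotent
  obtain ⟨y, hy⟩ := exists_ne (1 : K)
  have hcop : (orderOf x).Coprime (orderOf y) := by
    obtain ⟨k, hk⟩ := IsPGroup.iff_orderOf.1 h2 x
    rw [hk]
    exact (Nat.coprime_two_left.2 (h3.odd_orderOf_of_three y)).pow_left k
  have hyy : ¬ IsConj y y⁻¹ := fun hc => hy (eq_one_of_isConj_inv (h3.odd_orderOf_of_three y) hc)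
  rcases (h (x, y)).isConj_of_three rfl
    (zpowers_prodMk_eq_of_coprime hcop rfl Subgroup.zpowers_inv)
    (zpowers_prodMk_eq_of_coprime hcop hx rfl) with h1 | h1 | h1
  · exact absurd (h1.map_hom (MonoidHom.snd H K)) hyy
  · exact h1.map_hom (MonoidHom.fst H K)
  · exact absurd (h1.map_hom (MonoidHom.snd H K)).symm hyy

theorem exists_mulEquiv_prod_of_primeFactors_subset {G : Type u} [Group G] [Finite G]
    [Group.IsNilpotent G] (h : ∀ p, p.Prime → p ∣ Nat.card G → p = 2 ∨ p = 3) :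
    ∃ (H K : Subgroup G), IsPGroup 2 H ∧ IsPGroup 3 K ∧ Nonempty (G ≃* H × K) := by
  have : Fact (Nat.Prime 3) := ⟨Nat.prime_three⟩
  have : Fact (Nat.Prime 2) := ⟨Nat.prime_two⟩
  let P : Sylow 2 G := default
  let Q : Sylow 3 G := default
  have hnorm := (Group.isNilpotent_of_finite_tfae (G := G)).out 0 3 |>.1 ‹_›
  have hP : (P : Subgroup G).Normal := hnorm 2 ‹_› P
  have hQ : (Q : Subgroup G).Normal := hnorm 3 ‹_› Q
  have hd : Disjoint (P : Subgroup G) (Q : Subgroup G) :=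
    IsPGroup.disjoint_of_ne 2 3 (by decide) _ _ P.isPGroup' Q.isPGroup'
  have hcomm := Subgroup.commute_of_normal_of_disjoint _ _ hP hQ hd
  let f : P × Q →* G := MonoidHom.noncommCoprod (P : Subgroup G).subtype (Q : Subgroup G).subtype
    fun a b => hcomm a b a.2 b.2
  have hinj : Function.Injective f := by
    refine (MonoidHom.noncommCoprod_injective _ _ _).2 ⟨Subtype.val_injective, Subtype.val_injective, ?_⟩
    simpa using hd
  have hcard : Nat.card (P × Q) = Nat.card G := by
    rw [Nat.card_prod, Sylow.card_eq_multiplicity, Sylow.card_eq_multiplicity]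
    conv_rhs => rw [← Nat.prod_factorization_pow_eq_self (Nat.card_pos (α := G)).ne']
    rw [Finsupp.prod_of_support_subset (s := {2, 3}) _ ?_ _ (by simp)]
    · simp
    · intro p hp
      have := h p (Nat.prime_of_mem_primeFactors hp) (Nat.dvd_of_mem_primeFactors hp)
      simpa using this
  have hbij : Function.Bijective f := (Nat.bijective_iff_injective_and_card f).2 ⟨hinj, hcard⟩
  exact ⟨P, Q, P.isPGroup', Q.isPGroup', ⟨(MulEquiv.ofBijective f hbij).symm⟩⟩

theorem eq_two_or_eq_three_of_isSemiRational {G : Type u} [Group G] [Finite G]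
    [Group.IsNilpotent G] (h : IsSemiRational G) {p : ℕ} (hp : p.Prime) (hd : p ∣ Nat.card G) :
    p = 2 ∨ p = 3 := by
  have : Fact p.Prime := ⟨hp⟩
  obtain ⟨x, hx⟩ := exists_prime_orderOf_dvd_card' p hd
  refine hp.eq_two_or_odd'.imp_right fun hodd => ?_
  obtain ⟨n, hn⟩ := exists_pow_three_pow_eq_one_of_isConj
    (isConj_sq_inv_of_isSemiRational h (hx.symm ▸ hodd))
  have h3 := hp.dvd_of_dvd_pow (hx ▸ orderOf_dvd_of_pow_eq_one hn)
  exact (Nat.prime_dvd_prime_iff_eq hp Nat.prime_three).1 h3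

theorem mainTheorem9 (X : SemiRationalClass) (G : Type u) [Group G] [Finite G]
    [Group.IsNilpotent G] :
    (X.Contains G ↔
      (IsPGroup 2 G ∧ X.Contains G) ∨
      (IsPGroup 3 G ∧ X.Contains G) ∨
      ∃ (H K : Type u) (_ : Group H) (_ : Group K),
        (IsPGroup 2 H ∧ IsRationalGroup H) ∧
        (IsPGroup 3 K ∧ X.Contains K) ∧
        Nonempty (G ≃* H × K)) ∧
    ((IsPGroup 3 G ∧ X.Contains G) ↔ ∀ x : G, IsConj (x ^ 2) x⁻¹) := by
  refine ⟨⟨fun hX => ?_, ?_⟩, isPGroup_three_and_contains_iff X G⟩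
  · have hSR := hX.isSemiRational
    obtain ⟨H, K, h2, h3, ⟨e⟩⟩ := exists_mulEquiv_prod_of_primeFactors_subset
      fun p hp hd => eq_two_or_eq_three_of_isSemiRational hSR hp hd
    rcases subsingleton_or_nontrivial K with hK | hK
    · exact Or.inl ⟨h2.of_injective ((MonoidHom.fst H K).comp e.toMonoidHom)
        fun a b hab => e.injective (Prod.ext hab (Subsingleton.elim _ _)), hX⟩
    · refine Or.inr (Or.inr ⟨H, K, inferInstance, inferInstance,
        ⟨h2, isRationalGroup_of_isSemiRational_prod h2 h3 ?_⟩, ⟨h3, ?_⟩, ⟨e⟩⟩)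
      · exact hSR.of_surjective_of_section e.toMonoidHom e.symm.toMonoidHom (by simp)
      · have hKSR : IsSemiRational K := hSR.of_surjective_of_section
          ((MonoidHom.snd H K).comp e.toMonoidHom)
          (e.symm.toMonoidHom.comp (MonoidHom.inr H K)) (by simp)
        -- Only SR is passed down to `K`; the coincidence of the classes on 3-groups recovers `X`.
        exact ((isPGroup_three_and_contains_iff X K).2
          ((isPGroup_three_and_contains_iff .SR K).1 ⟨h3, hKSR⟩)).2
  · rintro (h | h | ⟨H, K, _, _, ⟨-, hH⟩, ⟨h3, hK⟩, ⟨e⟩⟩)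
    · exact h.2
    · exact h.2
    · exact X.contains_of_mulEquiv_prod hH h3 hK e
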